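/- All sets are sets of natural numbers and all partial functions are partial functions from $\mathbb{N}$ to $\mathbb{N}$. A partial function $\psi$ *pdominates* a partial function $\varphi$ if for all but finitely many $x \in \operatorname{dom}(\varphi)$ there is a $y \in \operatorname{dom}(\psi)$ with $y \le x$ and $\psi(y) > \varphi(x)$. A set $A$ is *pdominant* if there is a single partial $A$-recursive function $\psi$ that pdominates every partial recursive function. Let $K$ denote the halting problem and $A' = \{e : \varphi_e^A(e) \text{ converges}\}$ the Turing jump of $A$; $A$ is *low* if $A' \le_T K$ and *superlow* if $A' \le_{tt} K$ (truth-table reducibility). **Theorem.** There is a recursively enumerable set $A$ which is pdominant and low; moreover, $A$ can be chosen to be superlow. -/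

import Mathlib

namespace PDom

/-- The characteristic function of a set of natural numbers, used as an oracle. -/
noncomputable def charFun (A : Set ℕ) : ℕ →. ℕ :=
  fun n => Part.some (A.indicator 1 n)

/-- `ψ` is a partial `A`-recursive function. -/
def PartialRecIn (A : Set ℕ) (ψ : ℕ →. ℕ) : Prop :=
  TuringReducible ψ (charFun A)

/-- Turing reducibility of sets, `B ≤_T C`. -/
def TuringLE (B C : Set ℕ) : Prop :=
  TuringReducible (charFun B) (charFun C)

/-- `ψ` pdominates `φ`: for almost all (all but finitely many) `x` in the domain of `φ` there is a
`y ≤ x` in the domain of `ψ` with `ψ y > φ x`. -/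
def PDominates (ψ φ : ℕ →. ℕ) : Prop :=
  ∀ᶠ x in Filter.cofinite, ∀ v ∈ φ x, ∃ y ≤ x, ∃ w ∈ ψ y, v < w

/-- `A` is pdominant: a single partial `A`-recursive function pdominates all partial recursive
functions. -/
def PDominant (A : Set ℕ) : Prop :=
  ∃ ψ : ℕ →. ℕ, PartialRecIn A ψ ∧ ∀ φ : ℕ →. ℕ, Nat.Partrec φ → PDominates ψ φ

/-- Programs with an oracle; the constructors are the closure clauses of `Nat.RecursiveIn`. -/
inductive OracleCode : Type
  | zero : OracleCode
  | succ : OracleCode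
  | left : OracleCode
  | right : OracleCode
  | oracle : OracleCode
  | pair : OracleCode → OracleCode → OracleCode
  | comp : OracleCode → OracleCode → OracleCode
  | prec : OracleCode → OracleCode → OracleCode
  | rfind : OracleCode → OracleCode

namespace OracleCode

/-- The Gödel number of a program. -/
def index : OracleCode → ℕ
  | zero => 0
  | succ => 1
  | left => 2
  | right => 3
  | oracle => 4
  | pair c d => 4 * Nat.pair c.index d.index + 5
  | comp c d => 4 * Nat.pair c.index d.index + 6
  | prec c d => 4 * Nat.pair c.index d.index + 7
  | rfind c => 4 * c.index + 8

/-- The partial function computed by a program with oracle `g`. -/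
def eval (g : ℕ →. ℕ) : OracleCode → ℕ →. ℕ
  | zero => fun _ => Part.some 0
  | succ => fun n => Part.some (n + 1)
  | left => fun n => Part.some n.unpair.1
  | right => fun n => Part.some n.unpair.2
  | oracle => g
  | pair c d => fun n => Nat.pair <$> eval g c n <*> eval g d n
  | comp c d => fun n => eval g d n >>= eval g c
  | prec c d => fun p =>
      let (a, n) := Nat.unpair p
      n.rec (eval g c a) fun y IH => do
        let i ← IH
        eval g d (Nat.pair a (Nat.pair y i))
  | rfind c => fun a => Nat.rfind fun n => (fun m => m = 0) <$> eval g c (Nat.pair a n)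

/-- Every natural number is the Gödel number of exactly one program. -/
theorem index_bijective : Function.Bijective index := by
  constructor
  · intro c
    induction c with
    | pair a b iha ihb | comp a b iha ihb | prec a b iha ihb =>
      intro d h
      cases d <;> simp only [index] at h <;> try omega
      rename_i a' b'
      have h' : Nat.pair a.index b.index = Nat.pair a'.index b'.index := by omega
      rw [iha (Nat.pair_eq_pair.1 h').1, ihb (Nat.pair_eq_pair.1 h').2]
    | rfind a iha =>
      intro d h
      cases d <;> simp only [index] at h <;> try omega
      rename_i a'
      have h' : a.index = a'.index := by omega
      rw [iha h']
    | _ =>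
      intro d h
      cases d <;> simp only [index] at h <;> first | rfl | omega
  · intro n
    induction n using Nat.strong_induction_on with
    | _ n ih =>
      by_cases h : n < 5
      · interval_cases n
        exacts [⟨zero, rfl⟩, ⟨succ, rfl⟩, ⟨left, rfl⟩, ⟨right, rfl⟩, ⟨oracle, rfl⟩]
      · obtain ⟨c, hc⟩ := ih ((n - 5) / 4) (by omega)
        obtain ⟨a, ha⟩ := ih ((n - 5) / 4).unpair.1
          (by have := Nat.unpair_left_le ((n - 5) / 4); omega)
        obtain ⟨b, hb⟩ := ih ((n - 5) / 4).unpair.2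
          (by have := Nat.unpair_right_le ((n - 5) / 4); omega)
        have hp : Nat.pair a.index b.index = (n - 5) / 4 := by rw [ha, hb, Nat.pair_unpair]
        have hr : (n - 5) % 4 < 4 := Nat.mod_lt _ (by norm_num)
        interval_cases hm : (n - 5) % 4
        · exact ⟨pair a b, by simp only [index]; omega⟩
        · exact ⟨comp a b, by simp only [index]; omega⟩
        · exact ⟨prec a b, by simp only [index]; omega⟩
        · exact ⟨rfind c, by simp only [index]; omega⟩

/-- The programs with oracle `g` compute exactly the partial functions recursive in `g`. -/
theorem exists_eval_eq_iff (g f : ℕ →. ℕ) : (∃ c, eval g c = f) ↔ TuringReducible f g := by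
  rw [TuringReducible, RecursiveIn.iff_nat]
  constructor
  · rintro ⟨c, rfl⟩
    induction c with
    | zero => exact .zero
    | succ => exact .succ
    | left => exact .left
    | right => exact .right
    | oracle => exact .oracle _ rfl
    | pair c d hc hd => exact .pair hc hd
    | comp c d hc hd => exact .comp hc hd
    | prec c d hc hd => exact .prec hc hd
    | rfind c hc => exact .rfind hc
  · intro h
    induction h with
    | zero => exact ⟨zero, rfl⟩
    | succ => exact ⟨succ, rfl⟩
    | left => exact ⟨left, rfl⟩
    | right => exact ⟨right, rfl⟩
    | oracle f hf => exact ⟨oracle, (Set.mem_singleton_iff.1 hf).symm⟩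
    | pair _ _ hc hd =>
      obtain ⟨c, rfl⟩ := hc
      obtain ⟨d, rfl⟩ := hd
      exact ⟨pair c d, rfl⟩
    | comp _ _ hc hd =>
      obtain ⟨c, rfl⟩ := hc
      obtain ⟨d, rfl⟩ := hd
      exact ⟨comp c d, rfl⟩
    | prec _ _ hc hd =>
      obtain ⟨c, rfl⟩ := hc
      obtain ⟨d, rfl⟩ := hd
      exact ⟨prec c d, rfl⟩
    | rfind _ hc =>
      obtain ⟨c, rfl⟩ := hc
      exact ⟨rfind c, rfl⟩

end OracleCode

/-- The Turing jump `A' = {e : φ_e^A(e) converges}`, where `φ_e^A` is the function computed with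
oracle `A` by the unique program with Gödel number `e`. -/
def jump (A : Set ℕ) : Set ℕ :=
  {e | ∃ c : OracleCode, c.index = e ∧ (c.eval (charFun A) e).Dom}

/-- The (diagonal) halting problem `K = {e : φ_e(e) converges}`. -/
def haltingSet : Set ℕ :=
  {e | ((Denumerable.ofNat Nat.Partrec.Code e).eval e).Dom}

open Classical in
/-- Truth-table reducibility `B ≤_tt C`: from `n` one computes a finite list of queries together
with a finite table of accepted answer vectors, and `n ∈ B` iff the vector of correct answers
about `C` is one of the accepted ones. -/
def TTReducible (B C : Set ℕ) : Prop :=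
  ∃ f : ℕ → List ℕ × List (List Bool), Computable f ∧
    ∀ n, n ∈ B ↔ (f n).1.map (fun k => decide (k ∈ C)) ∈ (f n).2

/-- `A` is low: `A' ≤_T K`. -/
def Low (A : Set ℕ) : Prop :=
  TuringLE (jump A) haltingSet

/-- `A` is superlow: `A' ≤_tt K`. -/
def Superlow (A : Set ℕ) : Prop :=
  TTReducible (jump A) haltingSet

end PDom

/-!
A single effective construction produces the set. It runs through stages `0, 1, 2, …`, and the set
is a set of stages. A stage may code an *event*: some `φ_e(x)` has just been seen to converge, where
`2 ^ (n + 1) ≤ x < 2 ^ (n + 2)` and `e ≤ n`. Its *level* is then `n`, so that only finitely many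
stages, effectively bounded in number, have level at most `n`. For the jump of the set to be
superlow, there is for each `i` a requirement that protects the initial segment used by the first
diagonal computation `φ_i^A(i)` seen to converge. The only rule is that stage `t` enumerates all
earlier stages of at least its own level, except those that a requirement `i < level t` protects
(`Enumerates`).

*Superlowness.* Requirement `i` can only be injured by stages of level at most `i`
(`IsPriorityConstruction.use_succ_of_lt`). So the natural approximation to the jump changes at most
a computable number of times (`IsPriorityConstruction.changes_le`), which makes the jump truth-table
reducible to the halting problem (`ttReducible_of_changes_le`), hence also Turing reducible to it
(`TTReducible.turingLE`).

*Pdominance.* The crucial bound is that at most `2 ^ n` stages of level `n` are outside of the set,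
however often the requirements are injured
(`IsPriorityConstruction.card_survivors_le_weight`). The active requirements `i < n` are read as
digits of a binary number, requirement `0` being the most significant one. A stage of level `k ≤ n`
keeps the active requirements `i < k`, and apart from itself it leaves only those stages of level
`n` outside that are paid for by the digits of these; a requirement that becomes active pays with
its digit for all the less significant ones, which may be lost later on. So the `j`-th
surviving stage `s` of level `n` can be given the position `y = 2 ^ n + j < 2 ^ (n + 1)`, and
`ψ y = s + 1` defines a function that is partial recursive in the set. If the convergence of
`φ_e(x)` is seen at stage `t` of level `n`, then the value is at most `t`. Some stage `s ≥ t` of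
level at most `n` survives (`IsPriorityConstruction.exists_survivor`), and its position is below
`2 ^ (n + 1) ≤ x`.

Computations with oracles are handled by translating programs with a finite oracle into ordinary
programs that get the oracle as part of their input (`OracleCode.eval_toCode`). As the translation
is primitive recursive in the Gödel number (`primrec_indexCode`), Mathlib's universal step-bounded
evaluation applies.
-/

namespace PDom

open Nat.Partrec (Code)
open Encodable

/-! ### Oracle computations with finite oracles -/

namespace OracleCode

variable (g : ℕ →. ℕ) (c d : OracleCode)

theorem eval_pair (n : ℕ) :
    eval g (pair c d) n = (eval g c n).bind fun a => (eval g d n).map (Nat.pair a) := by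
  change (Nat.pair <$> eval g c n <*> eval g d n : Part ℕ) = _
  simp [Seq.seq, Part.bind_map]

theorem eval_comp (n : ℕ) : eval g (comp c d) n = (eval g d n).bind fun a => eval g c a := rfl

theorem eval_prec_zero (a : ℕ) : eval g (prec c d) (Nat.pair a 0) = eval g c a := by
  simp [eval]

theorem eval_prec_succ (a m : ℕ) :
    eval g (prec c d) (Nat.pair a (m + 1)) =
      (eval g (prec c d) (Nat.pair a m)).bind fun i => eval g d (Nat.pair a (Nat.pair m i)) := by
  simp [eval]

theorem mem_eval_rfind {n v : ℕ} :
    v ∈ eval g (rfind c) n ↔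
      0 ∈ eval g c (Nat.pair n v) ∧ ∀ m < v, ∃ b ∈ eval g c (Nat.pair n m), b ≠ 0 := by
  refine Nat.mem_rfind.trans ?_
  simp [Part.mem_map_iff]

/-- Enlarging the oracle preserves convergent computations. -/
theorem eval_mono {g h : ℕ →. ℕ} (hgh : ∀ n, ∀ v ∈ g n, v ∈ h n) (c : OracleCode) :
    ∀ n, ∀ v ∈ eval g c n, v ∈ eval h c n := by
  induction c with
  | zero | succ | left | right => exact fun n v hv => hv
  | oracle => exact hgh
  | pair c d ihc ihd =>
    intro n v hv
    simp only [eval_pair, Part.mem_bind_iff, Part.mem_map_iff] at hv ⊢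
    obtain ⟨a, ha, b, hb, rfl⟩ := hv
    exact ⟨a, ihc _ _ ha, b, ihd _ _ hb, rfl⟩
  | comp c d ihc ihd =>
    intro n v hv
    simp only [eval_comp, Part.mem_bind_iff] at hv ⊢
    obtain ⟨a, ha, hb⟩ := hv
    exact ⟨a, ihd _ _ ha, ihc _ _ hb⟩
  | prec c d ihc ihd =>
    intro n
    rw [← Nat.pair_unpair n]
    generalize n.unpair.1 = a
    induction n.unpair.2 with
    | zero => simpa only [eval_prec_zero] using ihc a
    | succ m ih =>
      intro v hv
      simp only [eval_prec_succ, Part.mem_bind_iff] at hv ⊢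
      obtain ⟨i, hi, hv⟩ := hv
      exact ⟨i, ih _ hi, ihd _ _ hv⟩
  | rfind c ih =>
    intro n v hv
    rw [mem_eval_rfind] at hv ⊢
    refine ⟨ih _ _ hv.1, fun m hm => ?_⟩
    obtain ⟨b, hb, h0⟩ := hv.2 m hm
    exact ⟨b, ih _ _ hb, h0⟩

/-- A convergent computation uses only finitely many oracle answers: if an oracle is the union of
an increasing sequence of oracles, then each convergent computation already converges for some
member of the sequence. -/
theorem exists_eval_of_iUnion {g : ℕ → ℕ →. ℕ} {h : ℕ →. ℕ}
    (hmono : ∀ s t, s ≤ t → ∀ n, ∀ v ∈ g s n, v ∈ g t n)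
    (hun : ∀ n, ∀ v ∈ h n, ∃ s, v ∈ g s n) (c : OracleCode) :
    ∀ n, ∀ v ∈ eval h c n, ∃ s, v ∈ eval (g s) c n := by
  have mono : ∀ {s t : ℕ}, s ≤ t → ∀ {c : OracleCode} {n v : ℕ}, v ∈ eval (g s) c n →
      v ∈ eval (g t) c n := fun {s t} hst {c n v} hv => eval_mono (hmono s t hst) c n v hv
  induction c with
  | zero | succ | left | right => exact fun n v hv => ⟨0, hv⟩
  | oracle => exact hun
  | pair c d ihc ihd =>
    intro n v hv
    simp only [eval_pair, Part.mem_bind_iff, Part.mem_map_iff] at hv ⊢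
    obtain ⟨a, ha, b, hb, rfl⟩ := hv
    obtain ⟨s, hs⟩ := ihc _ _ ha
    obtain ⟨t, ht⟩ := ihd _ _ hb
    exact ⟨max s t, a, mono (le_max_left _ _) hs, b, mono (le_max_right _ _) ht, rfl⟩
  | comp c d ihc ihd =>
    intro n v hv
    simp only [eval_comp, Part.mem_bind_iff] at hv ⊢
    obtain ⟨a, ha, hb⟩ := hv
    obtain ⟨s, hs⟩ := ihd _ _ ha
    obtain ⟨t, ht⟩ := ihc _ _ hb
    exact ⟨max s t, a, mono (le_max_left _ _) hs, mono (le_max_right _ _) ht⟩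
  | prec c d ihc ihd =>
    intro n
    rw [← Nat.pair_unpair n]
    generalize n.unpair.1 = a
    induction n.unpair.2 with
    | zero => simpa only [eval_prec_zero] using ihc a
    | succ m ih =>
      intro v hv
      simp only [eval_prec_succ, Part.mem_bind_iff] at hv ⊢
      obtain ⟨i, hi, hv⟩ := hv
      obtain ⟨s, hs⟩ := ih i hi
      obtain ⟨t, ht⟩ := ihd _ _ hv
      exact ⟨max s t, i, mono (le_max_left _ _) hs, mono (le_max_right _ _) ht⟩
  | rfind c ih =>
    intro n v hv
    simp only [mem_eval_rfind] at hv ⊢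
    have h3 : ∀ m, ∃ s, m < v → ∃ b ∈ eval (g s) c (Nat.pair n m), b ≠ 0 := by
      intro m
      by_cases hm : m < v
      · obtain ⟨b, hb, h0⟩ := hv.2 m hm
        obtain ⟨s, hs⟩ := ih _ _ hb
        exact ⟨s, fun _ => ⟨b, hs, h0⟩⟩
      · exact ⟨0, fun h => absurd h hm⟩
    choose f hf using h3
    obtain ⟨s, hs⟩ := ih _ _ hv.1
    refine ⟨max s ((Finset.range v).sup f), mono (le_max_left _ _) hs, fun m hm => ?_⟩
    obtain ⟨b, hb, h0⟩ := hf m hm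
    exact ⟨b, mono (le_max_of_le_right (Finset.le_sup (f := f) (Finset.mem_range.2 hm))) hb, h0⟩

end OracleCode

/-- The oracle that answers according to the finite list `l` of bits, and diverges on questions
beyond its end. -/
def listOracle (l : List Bool) : ℕ →. ℕ :=
  fun n => ((l[n]?).map Bool.toNat : Option ℕ)

open Classical in
/-- The first `s` bits of the characteristic sequence of `A`. -/
noncomputable def charPrefix (A : Set ℕ) (s : ℕ) : List Bool :=
  (List.range s).map fun k => decide (k ∈ A)

@[simp]
theorem length_charPrefix (A : Set ℕ) (s : ℕ) : (charPrefix A s).length = s := by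
  simp [charPrefix]

open Classical in
theorem getElem?_charPrefix {A : Set ℕ} {s k : ℕ} (h : k < s) :
    (charPrefix A s)[k]? = some (decide (k ∈ A)) := by
  simp [charPrefix, h]

theorem take_charPrefix (A : Set ℕ) {s t : ℕ} (h : s ≤ t) :
    (charPrefix A t).take s = charPrefix A s := by
  simp [charPrefix, ← List.map_take, List.take_range, h]

open Classical in
theorem charFun_apply (A : Set ℕ) (n : ℕ) : charFun A n = Part.some (decide (n ∈ A)).toNat := by
  by_cases h : n ∈ A <;> simp [charFun, h]

theorem mem_listOracle_take {l : List Bool} {s n v : ℕ} (h : v ∈ listOracle (l.take s) n) :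
    v ∈ listOracle l n := by
  simp only [listOracle, Part.mem_ofOption, Option.mem_def, Option.map_eq_some_iff,
    List.getElem?_take] at h ⊢
  obtain ⟨b, h, rfl⟩ := h
  split_ifs at h
  exact ⟨b, h, rfl⟩

theorem mem_charFun_of_mem_listOracle {A : Set ℕ} {s n v : ℕ}
    (h : v ∈ listOracle (charPrefix A s) n) : v ∈ charFun A n := by
  classical
  simp only [listOracle, Part.mem_ofOption, Option.mem_def, Option.map_eq_some_iff] at h
  obtain ⟨b, h, rfl⟩ := h
  have hn : n < s := by
    have := (List.getElem?_eq_some_iff.1 h).1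
    simpa using this
  rw [getElem?_charPrefix hn, Option.some_inj] at h
  rw [charFun_apply, ← h]
  exact Part.mem_some _

/-- A computation with oracle `A` converges iff it converges for some finite piece of `A`. -/
theorem eval_charFun_dom_iff (A : Set ℕ) (c : OracleCode) (n : ℕ) :
    (c.eval (charFun A) n).Dom ↔ ∃ s, (c.eval (listOracle (charPrefix A s)) n).Dom := by
  classical
  simp only [Part.dom_iff_mem]
  constructor
  · rintro ⟨v, hv⟩
    obtain ⟨s, hs⟩ := OracleCode.exists_eval_of_iUnion
      (g := fun s => listOracle (charPrefix A s)) (h := charFun A)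
      (fun s t hst n v hv => by
        rw [← take_charPrefix A hst] at hv
        exact mem_listOracle_take hv)
      (fun n v hv => ⟨n + 1, by
        rw [charFun_apply] at hv
        rwa [listOracle, getElem?_charPrefix (Nat.lt_succ_self n)]⟩) c n v hv
    exact ⟨s, v, hs⟩
  · rintro ⟨s, v, hv⟩
    exact ⟨v, OracleCode.eval_mono (fun n v => mem_charFun_of_mem_listOracle) c n v hv⟩

/-! ### Bounded quantifiers -/

theorem primrecPred_exists_lt {α : Type*} [Primcodable α] {f : α → ℕ} {p : α → ℕ → Prop}
    (hf : Primrec f) (hp : PrimrecRel p) : PrimrecPred fun a => ∃ i < f a, p a i := by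
  have h : PrimrecPred fun a => ∃ i ∈ List.range (f a), p a i :=
    PrimrecRel.exists_mem_list (R := fun i a => p a i) (hp.comp Primrec.snd Primrec.fst).primrecRel
      |>.comp (Primrec.list_range.comp hf) Primrec.id
  exact h.of_eq fun a => by simp

theorem primrecPred_forall_lt {α : Type*} [Primcodable α] {f : α → ℕ} {p : α → ℕ → Prop}
    (hf : Primrec f) (hp : PrimrecRel p) : PrimrecPred fun a => ∀ i < f a, p a i := by
  have h : PrimrecPred fun a => ∀ i ∈ List.range (f a), p a i :=
    PrimrecRel.forall_mem_list (R := fun i a => p a i) (hp.comp Primrec.snd Primrec.fst).primrecRel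
      |>.comp (Primrec.list_range.comp hf) Primrec.id
  exact h.of_eq fun a => by simp

/-! ### Effective evaluation with finite oracles -/

theorem partrec_listOracle : Partrec₂ listOracle := by
  have : Computable fun p : List Bool × ℕ => (p.1[p.2]?).map Bool.toNat :=
    (Primrec.option_map Primrec.list_getElem? ((Primrec.dom_bool _).comp Primrec.snd).to₂).to_comp
  exact this.ofOption

/-- Some program without oracle evaluates the finite oracle given as the first component of its
input at the second component. -/
theorem exists_code_listOracle :
    ∃ o : Code, ∀ (l : List Bool) (n : ℕ), o.eval (Nat.pair (encode l) n) = listOracle l n := by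
  have h : Partrec fun m : ℕ =>
      listOracle ((decode (α := List Bool) m.unpair.1).getD []) m.unpair.2 :=
    partrec_listOracle.comp
      (Primrec.option_getD.comp (Primrec.decode.comp (Primrec.fst.comp Primrec.unpair))
        (Primrec.const [])).to_comp (Computable.snd.comp Computable.unpair)
  obtain ⟨o, ho⟩ := Code.exists_code.1 (Partrec.nat_iff.1 h)
  exact ⟨o, fun l n => by rw [ho]; simp⟩

/-- A program evaluating finite oracles. -/
noncomputable def listOracleCode : Code :=
  exists_code_listOracle.choose

theorem eval_listOracleCode (l : List Bool) (n : ℕ) :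
    listOracleCode.eval (Nat.pair (encode l) n) = listOracle l n :=
  exists_code_listOracle.choose_spec l n

section

variable (c d : Code) (n : ℕ)

theorem code_eval_pair :
    (Code.pair c d).eval n = (c.eval n).bind fun a => (d.eval n).map (Nat.pair a) := by
  change (Nat.pair <$> c.eval n <*> d.eval n : Part ℕ) = _
  simp [Seq.seq, Part.bind_map]

theorem code_eval_comp : (Code.comp c d).eval n = (d.eval n).bind fun a => c.eval a := rfl

theorem code_eval_left : Code.left.eval n = Part.some n.unpair.1 := rfl

theorem code_eval_right : Code.right.eval n = Part.some n.unpair.2 := rfl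

theorem mem_code_eval_rfind' {a v : ℕ} :
    v ∈ (Code.rfind' c).eval (Nat.pair a 0) ↔
      0 ∈ c.eval (Nat.pair a v) ∧ ∀ m < v, ∃ b ∈ c.eval (Nat.pair a m), b ≠ 0 := by
  have h : (Code.rfind' c).eval (Nat.pair a 0) =
      (Nat.rfind fun m => (c.eval (Nat.pair a m)).map fun i => decide (i = 0)) := by
    simp [Code.eval, Part.map_id']
  rw [h]
  refine Nat.mem_rfind.trans ?_
  simp [Part.mem_map_iff]

end

/-- The rearrangement `((s, a), b) ↦ (s, (a, b))`. -/
def reassocCode : Code :=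
  .pair (.comp .left .left) (.pair (.comp .right .left) .right)

theorem eval_reassocCode (s a b : ℕ) :
    reassocCode.eval (Nat.pair (Nat.pair s a) b) = Part.some (Nat.pair s (Nat.pair a b)) := by
  simp [reassocCode, code_eval_pair, code_eval_comp, code_eval_left, code_eval_right]

/-- The translation of the constructor `prec`, given the translations of its arguments. -/
def precCode (c d : Code) : Code :=
  .comp (.prec c (.comp d reassocCode)) (.pair (.pair .left (.comp .left .right))
    (.comp .right .right))

/-- The translation of the constructor `rfind`, given the translation of its argument. -/
def rfindCode (c : Code) : Code :=
  .comp (.rfind' (.comp c reassocCode)) (.pair Code.id .zero)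

/-- The translation of programs with oracle into programs without oracle that get the (finite)
oracle as the first component of their input. -/
noncomputable def OracleCode.toCode : OracleCode → Code
  | zero => .zero
  | succ => .comp .succ .right
  | left => .comp .left .right
  | right => .comp .right .right
  | oracle => listOracleCode
  | pair c d => .pair c.toCode d.toCode
  | comp c d => .comp c.toCode (.pair .left d.toCode)
  | prec c d => precCode c.toCode d.toCode
  | rfind c => rfindCode c.toCode

theorem OracleCode.eval_toCode (l : List Bool) (c : OracleCode) :
    ∀ n, c.toCode.eval (Nat.pair (encode l) n) = c.eval (listOracle l) n := by
  induction c with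
  | zero => exact fun n => rfl
  | succ | left | right =>
    intro n
    simp only [toCode, code_eval_comp, code_eval_right, Nat.unpair_pair, Part.bind_some]
    rfl
  | oracle => exact eval_listOracleCode l
  | pair c d ihc ihd => intro n; simp only [toCode, code_eval_pair, eval_pair, ihc, ihd]
  | comp c d ihc ihd =>
    intro n
    simp [toCode, code_eval_comp, code_eval_pair, code_eval_left, eval_comp, ihd, Part.bind_map,
      ihc]
  | prec c d ihc ihd =>
    intro n
    have h : (Code.pair (.pair .left (.comp .left .right)) (.comp .right .right)).eval
        (Nat.pair (encode l) n)
        = Part.some (Nat.pair (Nat.pair (encode l) n.unpair.1) n.unpair.2) := by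
      simp [code_eval_pair, code_eval_comp, code_eval_left, code_eval_right]
    rw [toCode, precCode, code_eval_comp, h, Part.bind_some]
    conv_rhs => rw [← Nat.pair_unpair n]
    generalize n.unpair.1 = a
    induction n.unpair.2 with
    | zero => rw [Code.eval_prec_zero, ihc, eval_prec_zero]
    | succ m ih =>
      rw [Code.eval_prec_succ, ih, eval_prec_succ]
      simp [code_eval_comp, eval_reassocCode, ihd]
  | rfind c ih =>
    intro n
    have h : (Code.pair Code.id .zero).eval (Nat.pair (encode l) n)
        = Part.some (Nat.pair (Nat.pair (encode l) n) 0) := by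
      rw [code_eval_pair, Code.eval_id, Part.bind_some,
        show Code.zero.eval (Nat.pair (encode l) n) = Part.some 0 from rfl, Part.map_some]
    rw [toCode, rfindCode, code_eval_comp, h, Part.bind_some]
    ext v
    simp only [mem_code_eval_rfind', mem_eval_rfind, code_eval_comp, eval_reassocCode,
      Part.bind_some, ih]

/-- The translation of the program with Gödel number `i`. -/
noncomputable def indexCode (i : ℕ) : Code :=
  ((Equiv.ofBijective _ OracleCode.index_bijective).symm i).toCode

theorem indexCode_index (c : OracleCode) : indexCode c.index = c.toCode := by
  rw [indexCode, show c.index = Equiv.ofBijective _ OracleCode.index_bijective c from rfl,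
    Equiv.symm_apply_apply]

theorem primrec₂_precCode : Primrec₂ precCode :=
  Code.primrec₂_comp.comp₂
    (Code.primrec₂_prec.comp₂ Primrec₂.left
      (Code.primrec₂_comp.comp₂ Primrec₂.right (Primrec₂.const _)))
    (Primrec₂.const _)

theorem primrec_rfindCode : Primrec rfindCode :=
  Code.primrec₂_comp.comp
    (Code.primrec_rfind'.comp (Code.primrec₂_comp.comp Primrec.id (Primrec.const _)))
    (Primrec.const _)

/-- One step of the course-of-values recursion computing `indexCode`: `l` lists the earlier
values. -/
noncomputable def indexCodeStep (l : List Code) : Option Code :=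
  if l.length < 5 then
    [OracleCode.zero.toCode, OracleCode.succ.toCode, OracleCode.left.toCode,
      OracleCode.right.toCode, OracleCode.oracle.toCode][l.length]?
  else
    (l[((l.length - 5) / 4).unpair.1]?).bind fun a =>
      (l[((l.length - 5) / 4).unpair.2]?).bind fun b =>
        if (l.length - 5) % 4 = 0 then some (.pair a b)
        else if (l.length - 5) % 4 = 1 then some (.comp a (.pair .left b))
        else if (l.length - 5) % 4 = 2 then some (precCode a b)
        else (l[(l.length - 5) / 4]?).map rfindCode

theorem primrec_indexCodeStep : Primrec indexCodeStep := by
  have hm : Primrec fun l : List Code => l.length - 5 :=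
    Primrec.nat_sub.comp Primrec.list_length (Primrec.const 5)
  have hq : Primrec fun l : List Code => (l.length - 5) / 4 :=
    Primrec.nat_div.comp hm (Primrec.const 4)
  have hr : Primrec fun l : List Code => (l.length - 5) % 4 :=
    Primrec.nat_mod.comp hm (Primrec.const 4)
  have hu := Primrec.unpair.comp hq
  have hl : Primrec fun p : (List Code × Code) × Code => p.1.1 := Primrec.fst.comp Primrec.fst
  have ha : Primrec fun p : (List Code × Code) × Code => p.1.2 := Primrec.snd.comp Primrec.fst
  have hb : Primrec fun p : (List Code × Code) × Code => p.2 := Primrec.snd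
  have hr' := hr.comp hl
  refine Primrec.ite (Primrec.nat_lt.comp Primrec.list_length (Primrec.const 5))
    (Primrec.list_getElem?.comp (Primrec.const _) Primrec.list_length) ?_
  refine Primrec.option_bind (Primrec.list_getElem?.comp Primrec.id (Primrec.fst.comp hu)) ?_
  refine Primrec.option_bind
    ((Primrec.list_getElem?.comp Primrec.id (Primrec.snd.comp hu)).comp Primrec.fst) ?_
  refine Primrec.ite (Primrec.eq.comp hr' (Primrec.const 0))
    (Primrec.option_some.comp (Code.primrec₂_pair.comp ha hb)) ?_
  refine Primrec.ite (Primrec.eq.comp hr' (Primrec.const 1))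
    (Primrec.option_some.comp (Code.primrec₂_comp.comp ha
      (Code.primrec₂_pair.comp (Primrec.const _) hb))) ?_
  refine Primrec.ite (Primrec.eq.comp hr' (Primrec.const 2))
    (Primrec.option_some.comp (primrec₂_precCode.comp ha hb)) ?_
  exact Primrec.option_map (Primrec.list_getElem?.comp hl (hq.comp hl))
    (primrec_rfindCode.comp Primrec.snd).to₂

theorem indexCodeStep_map_range (n : ℕ) :
    indexCodeStep ((List.range n).map indexCode) = some (indexCode n) := by
  have get : ∀ {k}, k < n → ((List.range n).map indexCode)[k]? = some (indexCode k) :=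
    fun h => by simp [h]
  obtain ⟨c, rfl⟩ := OracleCode.index_bijective.2 n
  rw [indexCodeStep, List.length_map, List.length_range]
  cases c with
  | zero | succ | left | right | oracle => rw [indexCode_index]; simp [OracleCode.index]
  | pair c d | comp c d | prec c d =>
    rw [if_neg (by simp only [OracleCode.index]; omega)]
    have hc := Nat.left_le_pair c.index d.index
    have hd := Nat.right_le_pair c.index d.index
    rw [show (OracleCode.index _ - 5) / 4 = Nat.pair c.index d.index by
      simp only [OracleCode.index]; omega, Nat.unpair_pair,
      get (by simp only [OracleCode.index]; omega), get (by simp only [OracleCode.index]; omega)]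
    simp only [Option.bind_some, indexCode_index]
    simp [OracleCode.index, OracleCode.toCode, Nat.add_mod]
  | rfind c =>
    have h1 : (c.rfind.index - 5) / 4 = c.index := by simp only [OracleCode.index]; omega
    have h2 : (c.rfind.index - 5) % 4 = 3 := by simp only [OracleCode.index]; omega
    have hlt : c.index < c.rfind.index := by simp only [OracleCode.index]; omega
    rw [if_neg (by simp only [OracleCode.index]; omega), h1, h2,
      get ((Nat.unpair_left_le _).trans_lt hlt), get ((Nat.unpair_right_le _).trans_lt hlt),
      get hlt]
    simp [indexCode_index, OracleCode.toCode]

theorem primrec_indexCode : Primrec indexCode := by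
  have := Primrec.nat_strong_rec (fun (_ : Unit) n => indexCode n)
    (g := fun _ l => indexCodeStep l) (primrec_indexCodeStep.comp Primrec.snd).to₂
    (fun _ n => indexCodeStep_map_range n)
  exact this.comp (Primrec.const ()) Primrec.id

/-- The bit list `l` makes the `i`-th diagonal computation converge: with some initial segment of
`l` as oracle, the `i`-th program converges at `i` within `l.length` steps. Initial segments are
needed since a computation of `k` steps only sees inputs below `k`, hence only short oracles. -/
def Converges (i : ℕ) (l : List Bool) : Prop :=
  ∃ s < l.length, (Code.evaln l.length (indexCode i) (Nat.pair (encode (l.take s)) i)).isSome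

theorem primrecRel_converges : PrimrecRel Converges := by
  have hl : Primrec fun p : (ℕ × List Bool) × ℕ => p.1.2 := Primrec.snd.comp Primrec.fst
  have hi : Primrec fun p : (ℕ × List Bool) × ℕ => p.1.1 := Primrec.fst.comp Primrec.fst
  have h : PrimrecRel fun (p : ℕ × List Bool) (s : ℕ) =>
      (Code.evaln p.2.length (indexCode p.1) (Nat.pair (encode (p.2.take s)) p.1)).isSome := by
    refine Primrec.primrecPred (p := fun q : (ℕ × List Bool) × ℕ => (Code.evaln q.1.2.length
      (indexCode q.1.1) (Nat.pair (encode (q.1.2.take q.2)) q.1.1)).isSome = true) ?_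
    have := Primrec.option_isSome.comp (Code.primrec_evaln.comp
      (Primrec.pair (Primrec.pair (Primrec.list_length.comp hl) (primrec_indexCode.comp hi))
        (Primrec₂.natPair.comp (Primrec.encode.comp (Primrec.list_take.comp Primrec.snd hl)) hi)))
    simpa using this
  exact (primrecPred_exists_lt (Primrec.list_length.comp Primrec.snd) h).primrecRel

theorem not_converges_nil (i : ℕ) : ¬ Converges i [] := by
  simp [Converges]

/-- `i` is in the jump of `A` iff some finite piece of `A` makes the `i`-th computation
converge. -/
theorem mem_jump_iff (A : Set ℕ) (i : ℕ) : i ∈ jump A ↔ ∃ s, Converges i (charPrefix A s) := by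
  obtain ⟨c, rfl⟩ := OracleCode.index_bijective.2 i
  have h1 : c.index ∈ jump A ↔ (c.eval (charFun A) c.index).Dom :=
    ⟨fun ⟨d, hd, h⟩ => OracleCode.index_bijective.1 hd ▸ h, fun h => ⟨c, rfl, h⟩⟩
  rw [h1, eval_charFun_dom_iff]
  simp only [Converges, length_charPrefix, indexCode_index, ← OracleCode.eval_toCode]
  constructor
  · rintro ⟨s, h⟩
    obtain ⟨v, hv⟩ := Part.dom_iff_mem.1 h
    obtain ⟨k, hk⟩ := Code.evaln_complete.1 hv
    refine ⟨max k (s + 1), s, by omega, Option.isSome_iff_exists.2 ⟨v, ?_⟩⟩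
    rw [take_charPrefix A (by omega)]
    exact Code.evaln_mono (le_max_left _ _) hk
  · rintro ⟨t, s, hs, h⟩
    rw [take_charPrefix A hs.le] at h
    obtain ⟨v, hv⟩ := Option.isSome_iff_exists.1 h
    exact ⟨s, Part.dom_iff_mem.2 ⟨v, Code.evaln_sound hv⟩⟩

/-! ### Counting changes -/

open Classical in
/-- The number of changes of the truth value in the sequence `p 0, p 1, …, p t`. -/
noncomputable def changes (p : ℕ → Prop) (t : ℕ) : ℕ :=
  Nat.rec 0 (fun s c => if p s ↔ p (s + 1) then c else c + 1) t

open Classical in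
theorem changes_succ (p : ℕ → Prop) (t : ℕ) :
    changes p (t + 1) = if p t ↔ p (t + 1) then changes p t else changes p t + 1 := rfl

theorem changes_mono (p : ℕ → Prop) : Monotone (changes p) :=
  monotone_nat_of_le_succ fun t => by rw [changes_succ]; split_ifs <;> omega

theorem odd_changes_iff {p : ℕ → Prop} (h0 : ¬ p 0) (t : ℕ) : Odd (changes p t) ↔ p t := by
  induction t with
  | zero => simpa [changes] using h0
  | succ t ih =>
    rw [changes_succ]
    split_ifs with h
    · rw [ih, h]
    · rw [Nat.odd_add_one, ih]
      tauto

/-! ### The combinatorics of the priority construction -/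

/-- The rules of the construction. Stage `t` has level `lev t`, the set `a t` consists of the
numbers enumerated before stage `t`, and `use t i ≤ t` says that the `i`-th requirement is active
at stage `t` and protects `a t` below `use t i`. Stage `t` enumerates all `s < t` of level at least
`lev t` that no active requirement `i < lev t` protects. An active requirement stays active with
the same use as long as nothing below its use is enumerated. -/
structure IsPriorityConstruction (lev : ℕ → ℕ) (a : ℕ → ℕ → Prop) (use : ℕ → ℕ → ℕ) : Prop where
  zero (s : ℕ) : ¬ a 0 s
  succ (t s : ℕ) : a (t + 1) s ↔
    a t s ∨ s < t ∧ lev t ≤ lev s ∧ ∀ i < lev t, use t i ≤ t → use t i ≤ s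
  use_succ (t i : ℕ) (ht : use t i ≤ t) (h : ∀ s < use t i, a (t + 1) s → a t s) :
    use (t + 1) i = use t i

namespace IsPriorityConstruction

open Finset

/-- The active requirements among the first `k` ones, weighted by `2 ^ (n - 1 - i)`, as the digits
of a binary number. -/
def weight (use : ℕ → ℕ → ℕ) (n t k : ℕ) : ℕ :=
  ∑ i ∈ range k, if use t i ≤ t then 2 ^ (n - 1 - i) else 0

open Classical in
/-- The stages below `b` of level `n` that have not been enumerated before stage `t`. -/
noncomputable def survivors (lev : ℕ → ℕ) (a : ℕ → ℕ → Prop) (n t b : ℕ) : Finset ℕ :=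
  {s ∈ range b | lev s = n ∧ ¬ a t s}

section weight

variable {use : ℕ → ℕ → ℕ} {n t i j k : ℕ}

theorem weight_mono (h : j ≤ k) : weight use n t j ≤ weight use n t k :=
  sum_le_sum_of_subset (range_subset_range.2 h)

theorem weight_succ_of_active (h : use t i ≤ t) :
    weight use n t (i + 1) = weight use n t i + 2 ^ (n - 1 - i) := by
  rw [weight, sum_range_succ, if_pos h]; rfl

theorem weight_add_one_le (h : i ≤ n) :
    weight use n t n + 1 ≤ weight use n t i + 2 ^ (n - i) := by
  induction h using Nat.decreasingInduction with
  | self => simp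
  | of_succ i hi ih =>
    refine ih.trans ?_
    have h1 : 2 ^ (n - i) = 2 ^ (n - 1 - i) + 2 ^ (n - 1 - i) := by
      rw [← two_mul, ← pow_succ']; congr 1; omega
    rw [weight, sum_range_succ, h1, show n - (i + 1) = n - 1 - i by omega]
    rw [weight]
    generalize 2 ^ (n - 1 - i) = x
    split_ifs <;> omega

theorem weight_add_one_le_of_not_active (h : i < n) (hi : ¬ use t i ≤ t) :
    weight use n t n + 1 ≤ weight use n t i + 2 ^ (n - 1 - i) := by
  have := weight_add_one_le (use := use) (t := t) (Nat.succ_le_of_lt h)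
  rw [weight, weight, sum_range_succ, if_neg hi, Nat.succ_eq_add_one,
    show n - (i + 1) = n - 1 - i by omega] at this
  exact this

end weight

variable {lev : ℕ → ℕ} {a : ℕ → ℕ → Prop} {use : ℕ → ℕ → ℕ}

theorem mem_survivors {n t b s : ℕ} :
    s ∈ survivors lev a n t b ↔ s < b ∧ lev s = n ∧ ¬ a t s := by
  simp [survivors]

theorem mono (h : IsPriorityConstruction lev a use) {t u : ℕ} (htu : t ≤ u) {s : ℕ} (hs : a t s) :
    a u s := by
  induction u, htu using Nat.le_induction with
  | base => exact hs
  | succ u _ ih => exact (h.succ u s).2 (Or.inl ih)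

theorem exists_stage (h : IsPriorityConstruction lev a use) {t u s : ℕ} (htu : t ≤ u)
    (ht : ¬ a t s) (hu : a u s) :
    ∃ v, t ≤ v ∧ s < v ∧ lev v ≤ lev s ∧ ∀ i < lev v, use v i ≤ v → use v i ≤ s := by
  induction u, htu using Nat.le_induction with
  | base => exact absurd hu ht
  | succ u htu ih =>
    rcases (h.succ u s).1 hu with hu | hu
    · exact ih hu
    · exact ⟨u, htu, hu⟩

/-- A stage does not injure the requirements below its level. -/
theorem use_succ_of_lt (h : IsPriorityConstruction lev a use) {t i : ℕ} (ht : use t i ≤ t)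
    (hi : i < lev t) : use (t + 1) i = use t i := by
  refine h.use_succ t i ht fun s hs has => ?_
  rcases (h.succ t s).1 has with hat | ⟨-, -, hp⟩
  · exact hat
  · exact absurd (hp i hi ht) (by omega)

theorem weight_le_weight_succ (h : IsPriorityConstruction lev a use) {n t k : ℕ} (hk : k ≤ lev t) :
    weight use n t k ≤ weight use n (t + 1) k := by
  refine sum_le_sum fun i hi => ?_
  by_cases ht : use t i ≤ t
  · have := h.use_succ_of_lt ht ((mem_range.1 hi).trans_le hk)
    rw [if_pos ht, if_pos (by omega)]
  · simp [ht]

/-- The number of survivors of level `n` is bounded by the weight of the active requirements. The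
bound works like a binary counter: when requirement `i` becomes active, it may come to protect all
the present survivors of level `n`, but then its digit pays for all the digits of lower priority,
which may be lost later on. -/
theorem card_survivors_le_weight (h : IsPriorityConstruction lev a use) (n t : ℕ) :
    #(survivors lev a n t t) ≤ weight use n t n + 1 ∧
      ∀ i < n, use t i ≤ t →
        #(survivors lev a n t (use t i)) ≤ weight use n t (i + 1) := by
  induction t with
  | zero =>
    have h0 : ∀ b ≤ 0, #(survivors lev a n 0 b) = 0 := fun b hb => by
      simp [survivors, Nat.le_zero.1 hb]
    exact ⟨by simp [h0], fun i _ hi => by simp [h0 _ hi]⟩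
  | succ t ih =>
    obtain ⟨ih1, ih2⟩ := ih
    have hsub : ∀ {s}, ¬ a (t + 1) s → ¬ a t s := fun hs hat => hs (h.mono (Nat.le_succ t) hat)
    -- what a stage of level at most `n` leaves over was protected
    have hprot : lev t ≤ n → #(survivors lev a n (t + 1) t) ≤ weight use n t (lev t) := by
      intro hn
      by_cases hne : ({i ∈ range (lev t) | use t i ≤ t}).Nonempty
      · obtain ⟨i, hi, hmax⟩ := exists_max_image _ (use t) hne
        simp only [mem_filter, mem_range] at hi hmax
        refine le_trans (card_le_card fun s hs => ?_)
          ((ih2 i (by omega) hi.2).trans (weight_mono hi.1))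
        rw [mem_survivors] at hs ⊢
        refine ⟨?_, hs.2.1, hsub hs.2.2⟩
        by_contra hlt
        exact hs.2.2 ((h.succ t s).2 (Or.inr ⟨hs.1, by omega, fun j hj hjt =>
          (hmax j ⟨hj, hjt⟩).trans (not_lt.1 hlt)⟩))
      · have : survivors lev a n (t + 1) t = ∅ := by
          refine eq_empty_of_forall_notMem fun s hs => ?_
          rw [mem_survivors] at hs
          exact hs.2.2 ((h.succ t s).2 (Or.inr ⟨hs.1, by omega, fun j hj hjt =>
            absurd ⟨j, mem_filter.2 ⟨mem_range.2 hj, hjt⟩⟩ hne⟩))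
        simp [this]
    have hlt : lev t < n →
        #(survivors lev a n (t + 1) (t + 1)) ≤ weight use n t (lev t) := by
      intro hn
      refine le_trans (card_le_card fun s hs => ?_) (hprot hn.le)
      rw [mem_survivors] at hs ⊢
      have : s ≠ t := by rintro rfl; omega
      exact ⟨by omega, hs.2⟩
    have hle : lev t ≤ n →
        #(survivors lev a n (t + 1) (t + 1)) ≤ weight use n t (lev t) + 1 := by
      intro hn
      refine le_trans (card_le_card (t := insert t (survivors lev a n (t + 1) t)) fun s hs => ?_)
        ((card_insert_le _ _).trans (Nat.succ_le_succ (hprot hn)))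
      rw [mem_insert, mem_survivors]
      rw [mem_survivors] at hs
      by_cases hst : s = t
      · exact Or.inl hst
      · exact Or.inr ⟨by omega, hs.2⟩
    have hgt : n < lev t → #(survivors lev a n (t + 1) (t + 1)) ≤ weight use n t n + 1 := by
      intro hn
      refine le_trans (card_le_card fun s hs => ?_) ih1
      rw [mem_survivors] at hs ⊢
      have : s ≠ t := by rintro rfl; omega
      exact ⟨by omega, hs.2.1, hsub hs.2.2⟩
    constructor
    · rcases le_or_gt (lev t) n with hn | hn
      · exact (hle hn).trans (Nat.succ_le_succ
          ((h.weight_le_weight_succ le_rfl).trans (weight_mono hn)))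
      · exact (hgt hn).trans (Nat.succ_le_succ (h.weight_le_weight_succ hn.le))
    · intro i hin hi
      have hall : #(survivors lev a n (t + 1) (use (t + 1) i)) ≤
          #(survivors lev a n (t + 1) (t + 1)) := by
        refine card_le_card fun s hs => ?_
        rw [mem_survivors] at hs ⊢
        exact ⟨by omega, hs.2⟩
      rcases le_or_gt (lev t) i with hk | hk
      · exact hall.trans ((hlt (by omega)).trans
          ((h.weight_le_weight_succ le_rfl).trans (weight_mono (by omega))))
      · by_cases hit : use t i ≤ t
        · refine le_trans (card_le_card fun s hs => ?_)
            ((ih2 i hin hit).trans (h.weight_le_weight_succ hk))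
          rw [mem_survivors, h.use_succ_of_lt hit hk] at hs
          exact mem_survivors.2 ⟨hs.1, hs.2.1, hsub hs.2.2⟩
        · have h1 : #(survivors lev a n (t + 1) (t + 1)) ≤ weight use n t n + 1 := by
            rcases le_or_gt (lev t) n with hn | hn
            · exact (hle hn).trans (Nat.succ_le_succ (weight_mono hn))
            · exact hgt hn
          rw [weight_succ_of_active hi]
          exact hall.trans (h1.trans ((weight_add_one_le_of_not_active hin hit).trans
            (Nat.add_le_add_right (h.weight_le_weight_succ hk.le) _)))

theorem card_survivors_le (h : IsPriorityConstruction lev a use) (n t : ℕ) :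
    #(survivors lev a n t t) ≤ 2 ^ n := by
  refine (h.card_survivors_le_weight n t).1.trans ?_
  simpa [weight] using weight_add_one_le (use := use) (t := t) (Nat.zero_le n)

open Classical in
/-- A number of level `n` that is never enumerated has fewer than `2 ^ n` predecessors of the same
kind. -/
theorem card_lt_two_pow (h : IsPriorityConstruction lev a use) {s : ℕ} (hs : ∀ t, ¬ a t s) :
    #{s' ∈ range s | lev s' = lev s ∧ ¬ ∃ t, a t s'} < 2 ^ lev s := by
  refine lt_of_lt_of_le (Nat.lt_succ_self _) (le_trans ?_ (h.card_survivors_le (lev s) (s + 1)))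
  rw [Nat.succ_eq_add_one, ← card_insert_of_notMem (a := s) (by simp)]
  refine card_le_card fun s' hs' => ?_
  rw [mem_survivors]
  rw [mem_insert, mem_filter, mem_range] at hs'
  rcases hs' with rfl | ⟨h1, h2, h3⟩
  · exact ⟨by omega, rfl, hs _⟩
  · exact ⟨by omega, h2, fun ha => h3 ⟨_, ha⟩⟩

/-- Each stage is succeeded by a stage of at most its level that is never enumerated. -/
theorem exists_survivor (h : IsPriorityConstruction lev a use)
    (hfin : ∀ n, {t | lev t ≤ n}.Finite) (t : ℕ) :
    ∃ s, t ≤ s ∧ lev s ≤ lev t ∧ ∀ u, ¬ a u s := by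
  obtain ⟨s, hs, hmax⟩ :=
    Set.exists_max_image {s | lev s ≤ lev t} id (hfin (lev t)) ⟨t, le_refl (lev t)⟩
  refine ⟨s, hmax t (le_refl (lev t)), hs, fun u hu => ?_⟩
  obtain ⟨v, -, hsv, hv, -⟩ := h.exists_stage (Nat.zero_le u) (h.zero s) hu
  exact absurd (hmax v (hv.trans hs)) (by simpa using hsv)

/-- After the last stage of level at most `i`, an active requirement `i` stays active for good. -/
theorem use_eq_of_forall_lt (h : IsPriorityConstruction lev a use) {i t : ℕ} (ht : use t i ≤ t)
    (hlev : ∀ u ≥ t, i < lev u) {u : ℕ} (hu : t ≤ u) : use u i = use t i := by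
  induction u, hu using Nat.le_induction with
  | base => rfl
  | succ u htu ih => rw [h.use_succ_of_lt (by omega) (hlev u htu), ih]

theorem of_lt_use (h : IsPriorityConstruction lev a use) {i t : ℕ} (ht : use t i ≤ t)
    (hlev : ∀ u ≥ t, i < lev u) {u s : ℕ} (hs : s < use t i) (hu : a u s) : a t s := by
  by_contra hts
  have htu : t ≤ u := by
    by_contra hlt
    exact hts (h.mono (by omega) hu)
  obtain ⟨v, htv, -, -, hv⟩ := h.exists_stage htu hts hu
  have := h.use_eq_of_forall_lt ht hlev htv
  have := hv i (hlev v htv) (by omega)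
  omega

/-- The number of changes of the activity of requirement `i` is bounded in terms of the number of
stages of level at most `i`. -/
theorem changes_le (h : IsPriorityConstruction lev a use) (i t : ℕ) :
    changes (fun t => use t i ≤ t) t ≤
      2 * #{s ∈ range t | lev s ≤ i} + if use t i ≤ t then 1 else 0 := by
  induction t with
  | zero => exact Nat.zero_le _
  | succ t ih =>
    rw [changes_succ, range_add_one, filter_insert]
    have h1 : use t i ≤ t → ¬ use (t + 1) i ≤ t + 1 → lev t ≤ i := by
      intro h1 h2
      by_contra h3
      have := h.use_succ_of_lt h1 (not_le.1 h3)
      omega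
    split_ifs at ih ⊢ <;> simp_all <;> omega

end IsPriorityConstruction

/-! ### Recursively enumerable predicates and the halting problem -/

theorem rePred_exists {α : Type*} [Primcodable α] {p : α → ℕ → Prop} (hp : PrimrecRel p) :
    REPred fun a => ∃ n, p a n := by
  classical
  have h : Partrec fun a => Nat.rfind fun n => Part.some (decide (p a n)) :=
    Partrec.rfind (p := fun a n => Part.some (decide (p a n)))
      (PrimrecPred.decide hp).to_comp.partrec.to₂
  exact h.dom_re.of_eq fun a => Nat.rfind_dom.trans (by simp)

/-- Recursively enumerable predicates are many-one reducible to the halting problem. -/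
theorem exists_primrec_haltingSet {α : Type*} [Primcodable α] {p : α → Prop} (hp : REPred p) :
    ∃ q : α → ℕ, Primrec q ∧ ∀ a, q a ∈ haltingSet ↔ p a := by
  obtain ⟨c, hc⟩ := Code.exists_code.1 hp
  refine ⟨fun a => encode (Code.curry (.comp c .left) (encode a)),
    Primrec.encode.comp (Code.primrec₂_curry.comp (Primrec.const _) Primrec.encode), fun a => ?_⟩
  rw [haltingSet, Set.mem_ofPred_eq, Denumerable.ofNat_encode, Code.eval_curry, code_eval_comp,
    code_eval_left, Nat.unpair_pair, Part.bind_some, hc]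
  simp [Part.assert]

/-! ### Boundedly many changes and truth-table reducibility -/

theorem primrec₂_changes {p : ℕ → ℕ → Prop} (hp : PrimrecRel p) :
    Primrec₂ fun i t => changes (p i) t := by
  classical
  have h0 : PrimrecPred fun q : ℕ × ℕ × ℕ => p q.1 q.2.1 :=
    hp.comp Primrec.fst (Primrec.fst.comp Primrec.snd)
  have h1 : PrimrecPred fun q : ℕ × ℕ × ℕ => p q.1 (q.2.1 + 1) :=
    hp.comp Primrec.fst (Primrec.succ.comp (Primrec.fst.comp Primrec.snd))
  have h2 : PrimrecPred fun q : ℕ × ℕ × ℕ => p q.1 q.2.1 ↔ p q.1 (q.2.1 + 1) :=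
    ((h0.and h1).or (h0.not.and h1.not)).of_eq fun q => by tauto
  exact Primrec.nat_rec (Primrec.const 0) (Primrec.ite h2 (Primrec.snd.comp Primrec.snd)
    (Primrec.succ.comp (Primrec.snd.comp Primrec.snd))).to₂

/-- A set with a primitive recursive approximation whose number of changes is bounded by a
primitive recursive function is truth-table reducible to the halting problem: ask for each `k`
below the bound whether there are more than `k` changes, and accept if the number of changes, as
seen from the answers, is odd. -/
theorem ttReducible_of_changes_le {B : Set ℕ} {p : ℕ → ℕ → Prop} {b : ℕ → ℕ} (hp : PrimrecRel p)
    (hb : Primrec b) (h0 : ∀ i, ¬ p i 0) (hB : ∀ i, i ∈ B ↔ ∃ T, ∀ t ≥ T, p i t)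
    (hle : ∀ i t, changes (p i) t ≤ b i) : TTReducible B haltingSet := by
  classical
  obtain ⟨q, hq, hqK⟩ := exists_primrec_haltingSet (p := fun x : ℕ × ℕ =>
    ∃ t, x.2 < changes (p x.1) t) (rePred_exists
      (Primrec.nat_lt.comp (Primrec.snd.comp Primrec.fst)
        ((primrec₂_changes hp).comp (Primrec.fst.comp Primrec.fst) Primrec.snd)).primrecRel)
  -- an odd length, so that each odd number up to the length is `2 * d + 1` for some `d ≤ b i`
  have hL : Primrec fun i => List.range (2 * b i + 1) :=
    Primrec.list_range.comp (Primrec.nat_double_succ.comp hb)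
  refine ⟨fun i => ((List.range (2 * b i + 1)).map fun k => q (i, k),
    (List.range (b i + 1)).map fun d =>
      (List.range (2 * b i + 1)).map fun k => decide (k < 2 * d + 1)), ?_, fun i => ?_⟩
  · refine (Primrec.pair (Primrec.list_map hL hq.to₂) (Primrec.list_map
      (Primrec.list_range.comp (Primrec.succ.comp hb)) ?_)).to_comp
    refine Primrec.list_map (hL.comp Primrec.fst) ?_
    exact PrimrecPred.decide (Primrec.nat_lt.comp Primrec.snd
      (Primrec.nat_double_succ.comp (Primrec.snd.comp Primrec.fst)))
  · obtain ⟨T, hT⟩ : ∃ T, ∀ t ≥ T, changes (p i) t = changes (p i) T := by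
      obtain ⟨m, ⟨T, rfl⟩, hm⟩ := (Set.finite_Iic (b i) |>.subset
        (Set.range_subset_iff.2 (hle i))).exists_maximal (Set.range_nonempty (changes (p i)))
      exact ⟨T, fun t ht => le_antisymm (hm ⟨t, rfl⟩ (changes_mono _ ht)) (changes_mono _ ht)⟩
    have hiB : i ∈ B ↔ Odd (changes (p i) T) := by
      rw [hB]
      constructor
      · rintro ⟨U, hU⟩
        rw [← hT (max T U) (le_max_left _ _), odd_changes_iff (h0 i)]
        exact hU _ (le_max_right _ _)
      · exact fun h => ⟨T, fun t ht => by rwa [← odd_changes_iff (h0 i), hT t ht]⟩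
    have hK : ∀ k, q (i, k) ∈ haltingSet ↔ k < changes (p i) T := by
      intro k
      rw [hqK]
      refine ⟨fun ⟨t, ht⟩ => ?_, fun h => ⟨T, h⟩⟩
      rw [← hT (max T t) (le_max_left _ _)]
      exact lt_of_lt_of_le ht (changes_mono _ (le_max_right _ _))
    have hbT := hle i T
    rw [hiB]
    simp only [List.map_map, List.mem_map, List.mem_range, List.map_inj_left, Function.comp_apply,
      hK, decide_eq_decide]
    constructor
    · rintro ⟨d, hd⟩
      exact ⟨d, by omega, fun k _ => by rw [hd]⟩
    · rintro ⟨d, hd, h⟩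
      refine ⟨d, le_antisymm (not_lt.1 fun hlt => ?_) (not_lt.1 fun hlt => ?_)⟩
      · have := h (2 * d + 1) (by omega)
        omega
      · have := h (changes (p i) T) (by omega)
        omega

/-! ### Relative computability -/

theorem recursiveIn_some_comp {O : Set (ℕ →. ℕ)} {f g : ℕ → ℕ}
    (hf : Nat.RecursiveIn O fun n => Part.some (f n))
    (hg : Nat.RecursiveIn O fun n => Part.some (g n)) :
    Nat.RecursiveIn O fun n => Part.some (f (g n)) :=
  (hf.comp hg).of_eq fun n => Part.bind_some (g n) _

theorem recursiveIn_some_pair {O : Set (ℕ →. ℕ)} {f g : ℕ → ℕ}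
    (hf : Nat.RecursiveIn O fun n => Part.some (f n))
    (hg : Nat.RecursiveIn O fun n => Part.some (g n)) :
    Nat.RecursiveIn O fun n => Part.some (Nat.pair (f n) (g n)) :=
  (hf.pair hg).of_eq fun n => by simp [Seq.seq]

theorem recursiveIn_some_of_computable {O : Set (ℕ →. ℕ)} {f : ℕ → ℕ} (hf : Computable f) :
    Nat.RecursiveIn O fun n => Part.some (f n) :=
  Nat.Partrec.recursiveIn (Partrec.nat_iff.1 hf.partrec)

/-- The finite pieces of `A` are computable from `A`. -/
theorem recursiveIn_charPrefix (A : Set ℕ) :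
    Nat.RecursiveIn {charFun A} fun n => Part.some (encode (charPrefix A n)) := by
  classical
  let G : ℕ → ℕ := fun m =>
    encode ((decode (α := List Bool) m.unpair.1).getD [] ++ [decide (m.unpair.2 = 1)])
  have hG : Computable G := by
    have h1 : Primrec fun m : ℕ => (decode (α := List Bool) m.unpair.1).getD [] :=
      Primrec.option_getD.comp (Primrec.decode.comp (Primrec.fst.comp Primrec.unpair))
        (Primrec.const [])
    have h2 : Primrec fun m : ℕ => decide (m.unpair.2 = 1) :=
      PrimrecPred.decide (Primrec.eq.comp (Primrec.snd.comp Primrec.unpair) (Primrec.const 1))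
    exact (Primrec.encode.comp (Primrec.list_concat.comp h1 h2)).to_comp
  have hA : Nat.RecursiveIn {charFun A} fun n => Part.some (decide (n ∈ A)).toNat :=
    (Nat.RecursiveIn.oracle _ (Set.mem_singleton _)).of_eq (charFun_apply A)
  have hl : Nat.RecursiveIn {charFun A} fun m : ℕ => Part.some m.unpair.1 := .left
  have hr : Nat.RecursiveIn {charFun A} fun m : ℕ => Part.some m.unpair.2 := .right
  have hstep := recursiveIn_some_comp (recursiveIn_some_of_computable hG)
    (recursiveIn_some_pair (recursiveIn_some_comp hr hr)
      (recursiveIn_some_comp hA (recursiveIn_some_comp hl hr)))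
  have hrec := Nat.RecursiveIn.prec
    (recursiveIn_some_of_computable (O := {charFun A}) (Computable.const (encode ([] : List Bool))))
    hstep
  have hp : Nat.RecursiveIn {charFun A} fun n : ℕ => Part.some (Nat.pair 0 n) :=
    recursiveIn_some_of_computable
      (Primrec₂.natPair.comp (Primrec.const 0) Primrec.id).to_comp
  refine (hrec.comp hp).of_eq fun n => ?_
  refine (Part.bind_some _ _).trans ?_
  simp only [Nat.unpair_pair]
  induction n with
  | zero => simp [charPrefix]
  | succ n ih =>
    simp only [ih]
    refine (Part.bind_some _ _).trans ?_
    simp only [G, Nat.unpair_pair, encodek, Option.getD_some]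
    congr 3
    by_cases h : n ∈ A <;> simp [charPrefix, List.range_succ, h]

/-- Functions computed from their input and a finite piece of `A` of computable length are
computable from `A`. -/
theorem recursiveIn_of_charPrefix (A : Set ℕ) {F : ℕ → List Bool → ℕ} {l : ℕ → ℕ}
    (hF : Computable₂ F) (hl : Computable l) :
    Nat.RecursiveIn {charFun A} fun n => Part.some (F n (charPrefix A (l n))) := by
  have hF' : Computable fun m : ℕ =>
      F m.unpair.1 ((decode (α := List Bool) m.unpair.2).getD []) :=
    hF.comp (Computable.fst.comp Computable.unpair)
      (Primrec.option_getD.comp (Primrec.decode.comp (Primrec.snd.comp Primrec.unpair))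
        (Primrec.const [])).to_comp
  refine (recursiveIn_some_comp (recursiveIn_some_of_computable hF')
    (recursiveIn_some_pair (recursiveIn_some_of_computable Computable.id)
      (recursiveIn_some_comp (recursiveIn_charPrefix A)
        (recursiveIn_some_of_computable hl)))).of_eq fun n => by simp

theorem TTReducible.turingLE {B C : Set ℕ} (h : TTReducible B C) : TuringLE B C := by
  classical
  obtain ⟨f, hf, hB⟩ := h
  rw [TuringLE, TuringReducible, RecursiveIn.iff_nat]
  let l : ℕ → ℕ := fun n => (f n).1.foldr (fun k m => max (k + 1) m) 0
  let G : (List ℕ × List (List Bool)) × List Bool → ℕ := fun x =>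
    if x.1.1.map (fun k => x.2.getD k false) ∈ x.1.2 then 1 else 0
  let F : ℕ → List Bool → ℕ := fun n σ => G (f n, σ)
  have hl : Computable l := by
    have : Primrec fun L : List ℕ => L.foldr (fun k m => max (k + 1) m) 0 :=
      Primrec.list_foldr Primrec.id (Primrec.const 0) (Primrec.nat_max.comp
        (Primrec.succ.comp (Primrec.fst.comp Primrec.snd)) (Primrec.snd.comp Primrec.snd)).to₂
    exact this.to_comp.comp (Computable.fst.comp hf)
  have hF : Computable₂ F := by
    have h1 : Primrec fun x : (List ℕ × List (List Bool)) × List Bool =>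
        x.1.1.map fun k => x.2.getD k false :=
      Primrec.list_map (Primrec.fst.comp Primrec.fst)
        ((Primrec.list_getD false).comp (Primrec.snd.comp Primrec.fst) Primrec.snd)
    have h2 : PrimrecPred fun x : (List ℕ × List (List Bool)) × List Bool =>
        ∃ v ∈ x.1.2, v = x.1.1.map fun k => x.2.getD k false :=
      PrimrecRel.exists_mem_list (R := fun v (x : (List ℕ × List (List Bool)) × List Bool) =>
        v = x.1.1.map fun k => x.2.getD k false)
        (Primrec.eq.comp Primrec.fst (h1.comp Primrec.snd)).primrecRel
        |>.comp (Primrec.snd.comp Primrec.fst) Primrec.id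
    have h3 : Primrec G :=
      Primrec.ite (h2.of_eq fun x => by simp) (Primrec.const 1) (Primrec.const 0)
    exact h3.to_comp.comp (Computable.pair (hf.comp Computable.fst) Computable.snd)
  have hlt : ∀ (L : List ℕ), ∀ k ∈ L, k < L.foldr (fun k m => max (k + 1) m) 0 := by
    intro L
    induction L with
    | nil => simp
    | cons x L ih =>
      intro k hk
      rw [List.foldr_cons]
      rcases List.mem_cons.1 hk with rfl | hk
      · omega
      · have := ih k hk
        omega
  refine (recursiveIn_of_charPrefix C hF hl).of_eq fun n => ?_
  have hmap : (f n).1.map (fun k => (charPrefix C (l n)).getD k false) =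
      (f n).1.map fun k => decide (k ∈ C) := by
    refine List.map_congr_left fun k hk => ?_
    rw [List.getD_eq_getElem?_getD, getElem?_charPrefix (hlt _ k hk), Option.getD_some]
  simp only [F, G, hmap, charFun_apply, hB n]
  split_ifs with h <;> simp [h]

/-- Unbounded search for a number with a property decided by a finite piece of `A`. -/
theorem exists_partialRecIn_search (A : Set ℕ) {p : ℕ → ℕ → List Bool → Prop}
    (hp : PrimrecPred fun x : ℕ × ℕ × List Bool => p x.1 x.2.1 x.2.2) :
    ∃ ψ : ℕ →. ℕ, PartialRecIn A ψ ∧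
      ∀ y v, v ∈ ψ y ↔ ∃ s, v = s + 1 ∧ p y s (charPrefix A (s + 1)) ∧
        ∀ r < s, ¬ p y r (charPrefix A (r + 1)) := by
  classical
  have hF : Computable₂ fun (m : ℕ) (σ : List Bool) =>
      if p m.unpair.1 m.unpair.2 σ then 0 else 1 := by
    have hu := Primrec.unpair.comp (Primrec.fst (α := ℕ) (β := List Bool))
    exact (Primrec.ite (hp.comp (Primrec.pair (Primrec.fst.comp hu)
      (Primrec.pair (Primrec.snd.comp hu) Primrec.snd)))
      (Primrec.const 0) (Primrec.const 1)).to_comp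
  have hl : Computable fun m : ℕ => m.unpair.2 + 1 :=
    (Primrec.succ.comp (Primrec.snd.comp Primrec.unpair)).to_comp
  refine ⟨_, RecursiveIn.iff_nat.2
    (Nat.RecursiveIn.comp .succ (Nat.RecursiveIn.rfind (recursiveIn_of_charPrefix A hF hl))),
    fun y v => ?_⟩
  refine (Part.mem_bind_iff (g := fun s => Part.some (s + 1))).trans ?_
  simp only [Part.mem_some_iff]
  refine exists_congr fun s => ?_
  rw [and_comm]
  refine and_congr_right fun _ => Nat.mem_rfind.trans ?_
  simp

/-! ### The stages and their levels -/

/-- The tuple `(n, e, x, k, v)` describes an event of level `n`: the computation of the `e`-th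
partial recursive function, `e ≤ n`, at an argument `x` between `2 ^ (n + 1)` and `2 ^ (n + 2)`
converges with value `v` after exactly `k` steps. -/
def IsEvent (q : ℕ × ℕ × ℕ × ℕ × ℕ) : Prop :=
  q.2.1 ≤ q.1 ∧ 2 ^ (q.1 + 1) ≤ q.2.2.1 ∧ q.2.2.1 < 2 ^ (q.1 + 2) ∧
    Code.evaln q.2.2.2.1 (Denumerable.ofNat Code q.2.1) q.2.2.1 = some q.2.2.2.2 ∧
    Code.evaln (q.2.2.2.1 - 1) (Denumerable.ofNat Code q.2.1) q.2.2.1 = none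

theorem primrec_two_pow : Primrec fun n : ℕ => 2 ^ n :=
  (Primrec₂.unpaired'.1 Nat.Primrec.pow).comp (Primrec.const 2) Primrec.id

theorem primrecPred_isEvent : PrimrecPred IsEvent := by
  have hn : Primrec fun q : ℕ × ℕ × ℕ × ℕ × ℕ => q.1 := Primrec.fst
  have he : Primrec fun q : ℕ × ℕ × ℕ × ℕ × ℕ => q.2.1 := Primrec.fst.comp Primrec.snd
  have hx : Primrec fun q : ℕ × ℕ × ℕ × ℕ × ℕ => q.2.2.1 :=
    Primrec.fst.comp (Primrec.snd.comp Primrec.snd)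
  have hk : Primrec fun q : ℕ × ℕ × ℕ × ℕ × ℕ => q.2.2.2.1 :=
    Primrec.fst.comp (Primrec.snd.comp (Primrec.snd.comp Primrec.snd))
  have hv : Primrec fun q : ℕ × ℕ × ℕ × ℕ × ℕ => q.2.2.2.2 :=
    Primrec.snd.comp (Primrec.snd.comp (Primrec.snd.comp Primrec.snd))
  have hc := (Primrec.ofNat Code).comp he
  refine (Primrec.nat_le.comp he hn).and ((Primrec.nat_le.comp (primrec_two_pow.comp
    (Primrec.succ.comp hn)) hx).and ((Primrec.nat_lt.comp hx (primrec_two_pow.comp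
    (Primrec.succ.comp (Primrec.succ.comp hn)))).and (PrimrecPred.and ?_ ?_)))
  · exact Primrec.eq.comp (Code.primrec_evaln.comp (Primrec.pair (Primrec.pair hk hc) hx))
      (Primrec.option_some.comp hv)
  · exact Primrec.eq.comp (Code.primrec_evaln.comp (Primrec.pair (Primrec.pair
      (Primrec.pred.comp hk) hc) hx)) (Primrec.const none)

/-- An event is determined by the function and the argument. -/
theorem IsEvent.ext {q r : ℕ × ℕ × ℕ × ℕ × ℕ} (hq : IsEvent q) (hr : IsEvent r)
    (he : q.2.1 = r.2.1) (hx : q.2.2.1 = r.2.2.1) : q = r := by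
  obtain ⟨n, e, x, k, v⟩ := q
  obtain ⟨n', e', x', k', v'⟩ := r
  simp only [IsEvent] at hq hr he hx
  subst he hx
  obtain ⟨-, h1, h2, h3, h4⟩ := hq
  obtain ⟨-, h1', h2', h3', h4'⟩ := hr
  have hn : n = n' := by
    have := (Nat.pow_lt_pow_iff_right (a := 2) (by omega)).1 (h1.trans_lt h2')
    have := (Nat.pow_lt_pow_iff_right (a := 2) (by omega)).1 (h1'.trans_lt h2)
    omega
  have key : ∀ {k k' v}, Code.evaln k (Denumerable.ofNat Code e) x = some v →
      Code.evaln (k' - 1) (Denumerable.ofNat Code e) x = none → k' ≤ k := by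
    intro k k' v h h'
    by_contra hlt
    have := Code.evaln_mono (k₂ := k' - 1) (by omega) (Option.mem_def.2 h)
    rw [h'] at this
    cases this
  have hk : k = k' := le_antisymm (key h3' h4) (key h3 h4')
  subst hn hk
  rw [h3, Option.some_inj] at h3'
  rw [h3']

open Classical in
/-- The level of stage `t`: the level of the event with code `t`, if there is one. Otherwise the
stage serves no purpose, and gets a level that no other such stage has. -/
noncomputable def level (t : ℕ) : ℕ :=
  if IsEvent (Denumerable.ofNat _ t) then (Denumerable.ofNat (ℕ × ℕ × ℕ × ℕ × ℕ) t).1 else t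

theorem primrec_level : Primrec level := by
  classical
  exact Primrec.ite (primrecPred_isEvent.comp (Primrec.ofNat _))
    (Primrec.fst.comp (Primrec.ofNat _)) Primrec.id

theorem level_encode {q : ℕ × ℕ × ℕ × ℕ × ℕ} (hq : IsEvent q) : level (encode q) = q.1 := by
  rw [level, Denumerable.ofNat_encode, if_pos hq]

/-- The function and the argument of the event with code `t`. -/
def eventData (t : ℕ) : ℕ × ℕ :=
  ((Denumerable.ofNat (ℕ × ℕ × ℕ × ℕ × ℕ) t).2.1, (Denumerable.ofNat (ℕ × ℕ × ℕ × ℕ × ℕ) t).2.2.1)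

theorem injOn_eventData (i : ℕ) :
    Set.InjOn eventData {t | level t ≤ i ∧ IsEvent (Denumerable.ofNat _ t)} := by
  intro t ht u hu h
  rw [eventData, eventData, Prod.mk.injEq] at h
  have := ht.2.ext hu.2 h.1 h.2
  exact (Denumerable.eqv (ℕ × ℕ × ℕ × ℕ × ℕ)).symm.injective this

theorem mapsTo_eventData (i : ℕ) :
    Set.MapsTo eventData {t | level t ≤ i ∧ IsEvent (Denumerable.ofNat _ t)}
      (Finset.range (i + 1) ×ˢ Finset.range (2 ^ (i + 2)) : Finset (ℕ × ℕ)) := by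
  rintro t ⟨hi, ht⟩
  rw [level, if_pos ht] at hi
  have h2 : 2 ^ ((Denumerable.ofNat (ℕ × ℕ × ℕ × ℕ × ℕ) t).1 + 2) ≤ 2 ^ (i + 2) :=
    Nat.pow_le_pow_right (by omega) (by omega)
  have h1 := ht.1
  have h3 := ht.2.2.1
  simp only [Finset.coe_product, Set.mem_prod, Finset.coe_range, Set.mem_Iio, eventData]
  exact ⟨by omega, by omega⟩

theorem finite_level_le (i : ℕ) : {t | level t ≤ i}.Finite := by
  refine ((Set.Finite.of_injOn (mapsTo_eventData i) (injOn_eventData i)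
    (Finset.finite_toSet _)).union (Set.finite_Iic i)).subset fun t (ht : level t ≤ i) => ?_
  by_cases h : IsEvent (Denumerable.ofNat _ t)
  · exact Or.inl ⟨ht, h⟩
  · rw [level, if_neg h] at ht
    exact Or.inr ht

theorem card_level_le (i T : ℕ) :
    Finset.card {t ∈ Finset.range T | level t ≤ i} ≤ (i + 1) * 2 ^ (i + 2) + (i + 1) := by
  classical
  rw [← Finset.card_filter_add_card_filter_not (fun t => IsEvent (Denumerable.ofNat _ t))]
  refine Nat.add_le_add ?_ ?_
  · refine (Finset.card_le_card_of_injOn (t := Finset.range (i + 1) ×ˢ Finset.range (2 ^ (i + 2)))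
      eventData ?_ ?_).trans (by simp)
    · exact (mapsTo_eventData i).mono_left fun t ht => by
        simp only [Finset.coe_filter, Finset.mem_filter] at ht
        exact ⟨ht.1.2, ht.2⟩
    · exact (injOn_eventData i).mono fun t ht => by
        simp only [Finset.coe_filter, Finset.mem_filter] at ht
        exact ⟨ht.1.2, ht.2⟩
  · refine (Finset.card_le_card (t := Finset.range (i + 1)) fun t ht => ?_).trans (by simp)
    simp only [Finset.mem_filter] at ht
    have := ht.1.2
    rw [level, if_neg ht.2] at this
    exact Finset.mem_range.2 (by omega)

/-! ### The construction -/

open Classical in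
/-- The least length of an initial segment of `l` that makes the `i`-th diagonal computation
converge, or `l.length + 1` if there is none. -/
noncomputable def use (i : ℕ) (l : List Bool) : ℕ :=
  (List.range (l.length + 1)).findIdx fun s => decide (Converges i (l.take s))

theorem use_eq_iff {i s : ℕ} {l : List Bool} (hs : s ≤ l.length) :
    use i l = s ↔ Converges i (l.take s) ∧ ∀ j < s, ¬ Converges i (l.take j) := by
  rw [use, List.findIdx_eq (by simpa using Nat.lt_succ_of_le hs)]
  simp

open Classical in
theorem use_le_length_iff {i : ℕ} {l : List Bool} :
    use i l ≤ l.length ↔ ∃ s ≤ l.length, Converges i (l.take s) := by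
  have := List.findIdx_lt_length (p := fun s => decide (Converges i (l.take s)))
    (xs := List.range (l.length + 1))
  simpa [Nat.lt_succ_iff, use] using this

theorem primrec₂_use : Primrec₂ use := by
  classical
  have hl : Primrec fun p : (ℕ × List Bool) × ℕ => p.1.2 := Primrec.snd.comp Primrec.fst
  have hi : Primrec fun p : (ℕ × List Bool) × ℕ => p.1.1 := Primrec.fst.comp Primrec.fst
  have h : PrimrecPred fun p : (ℕ × List Bool) × ℕ => Converges p.1.1 (p.1.2.take p.2) :=
    primrecRel_converges.comp hi (Primrec.list_take.comp Primrec.snd hl)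
  exact Primrec.list_findIdx
    (Primrec.list_range.comp (Primrec.succ.comp (Primrec.list_length.comp Primrec.snd)))
    h.decide.to₂

/-- The rule by which stage `l.length` enumerates `s`, when `l` is the list of the decisions made
so far. -/
def Enumerates (l : List Bool) (s : ℕ) : Prop :=
  level l.length ≤ level s ∧ ∀ i < level l.length, use i l ≤ l.length → use i l ≤ s

theorem primrecRel_enumerates : PrimrecRel Enumerates := by
  have hl : Primrec fun p : (List Bool × ℕ) × ℕ => p.1.1 := Primrec.fst.comp Primrec.fst
  have hu : Primrec fun p : (List Bool × ℕ) × ℕ => use p.2 p.1.1 :=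
    primrec₂_use.comp Primrec.snd hl
  have hlev : Primrec fun p : List Bool × ℕ => level p.1.length :=
    primrec_level.comp (Primrec.list_length.comp Primrec.fst)
  have h : PrimrecPred fun p : (List Bool × ℕ) × ℕ =>
      use p.2 p.1.1 ≤ p.1.1.length → use p.2 p.1.1 ≤ p.1.2 :=
    ((Primrec.nat_le.comp hu (Primrec.list_length.comp hl)).not.or
      (Primrec.nat_le.comp hu (Primrec.snd.comp Primrec.fst))).of_eq fun p => by tauto
  exact (Primrec.nat_le.comp hlev (primrec_level.comp Primrec.snd)).and
    (primrecPred_forall_lt hlev h.primrecRel)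

open Classical in
/-- The list of the decisions made before stage `t` about the numbers below `t`. -/
noncomputable def state (t : ℕ) : List Bool :=
  Nat.rec [] (fun _ l => ((List.range l.length).map fun s =>
    decide (l.getD s false = true ∨ Enumerates l s)) ++ [false]) t

theorem primrec_state : Primrec state := by
  classical
  have hl : Primrec fun p : (ℕ × List Bool) × ℕ => p.1.2 := Primrec.snd.comp Primrec.fst
  have h : PrimrecPred fun p : (ℕ × List Bool) × ℕ =>
      p.1.2.getD p.2 false = true ∨ Enumerates p.1.2 p.2 :=
    (Primrec.eq.comp ((Primrec.list_getD false).comp hl Primrec.snd) (Primrec.const true)).or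
      (primrecRel_enumerates.comp hl Primrec.snd)
  exact Primrec.nat_rec₁ [] (Primrec.list_concat.comp (Primrec.list_map
    (Primrec.list_range.comp (Primrec.list_length.comp Primrec.snd)) h.decide.to₂)
    (Primrec.const false)).to₂

@[simp]
theorem length_state (t : ℕ) : (state t).length = t := by
  induction t with
  | zero => rfl
  | succ t ih => simpa [state] using ih

/-- `s` is enumerated before stage `t`. -/
def Enumerated (t s : ℕ) : Prop :=
  (state t).getD s false = true

theorem Enumerated.lt {t s : ℕ} (h : Enumerated t s) : s < t := by
  by_contra hlt
  rw [Enumerated, List.getD_eq_default _ _ (by simpa using hlt)] at h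
  cases h

theorem enumerated_succ (t s : ℕ) :
    Enumerated (t + 1) s ↔ Enumerated t s ∨ s < t ∧ Enumerates (state t) s := by
  classical
  have h : state (t + 1) = ((List.range (state t).length).map fun s =>
      decide ((state t).getD s false = true ∨ Enumerates (state t) s)) ++ [false] := rfl
  rw [length_state] at h
  rw [Enumerated, h, List.getD_eq_getElem?_getD]
  rcases lt_trichotomy s t with hlt | rfl | hlt
  · rw [List.getElem?_append_left (by simpa using hlt)]
    simp [hlt, Enumerated]
  · have : ¬ Enumerated s s := fun h => absurd h.lt (lt_irrefl s)
    simp [this]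
  · have h1 : ¬ Enumerated t s := fun h => absurd h.lt (by omega)
    rw [List.getElem?_eq_none (by simpa using hlt)]
    simp [h1, hlt.not_gt]

theorem state_eq_charPrefix (t : ℕ) : state t = charPrefix {s | Enumerated t s} t := by
  classical
  refine List.ext_getElem (by simp) fun s h1 h2 => ?_
  simp [charPrefix, Enumerated, List.getElem?_eq_getElem h1]

theorem charPrefix_congr {A B : Set ℕ} {s : ℕ} (h : ∀ k < s, k ∈ A ↔ k ∈ B) :
    charPrefix A s = charPrefix B s := by
  refine List.map_congr_left fun k hk => ?_
  rw [h k (List.mem_range.1 hk)]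

theorem take_state {t s : ℕ} (h : s ≤ t) :
    (state t).take s = charPrefix {s | Enumerated t s} s := by
  rw [state_eq_charPrefix, take_charPrefix _ h]

theorem isPriorityConstruction :
    IsPriorityConstruction level Enumerated fun t i => use i (state t) where
  zero s h := absurd h.lt (Nat.not_lt_zero s)
  succ t s := by rw [enumerated_succ, Enumerates, length_state]
  use_succ t i ht h := by
    have hc : ∀ s ≤ use i (state t), (state (t + 1)).take s = (state t).take s := by
      intro s hs
      rw [take_state (hs.trans (ht.trans (Nat.le_succ t))), take_state (hs.trans ht)]
      exact charPrefix_congr fun k hk =>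
        ⟨h k (by omega), fun h => (enumerated_succ t k).2 (Or.inl h)⟩
    obtain ⟨h1, h2⟩ := (use_eq_iff (by simpa using ht)).1 (Eq.refl (use i (state t)))
    rw [use_eq_iff (by rw [length_state]; omega), hc _ le_rfl]
    exact ⟨h1, fun j hj => hc j hj.le ▸ h2 j hj⟩

/-- The set of all numbers that are ever enumerated. -/
def pdomSet : Set ℕ :=
  {s | ∃ t, Enumerated t s}

theorem rePred_pdomSet : REPred fun s => s ∈ pdomSet :=
  rePred_exists (p := fun s t => Enumerated t s) (Primrec.eq.comp ((Primrec.list_getD false).comp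
    (primrec_state.comp Primrec.snd) Primrec.fst) (Primrec.const true)).primrecRel

/-! ### Superlowness -/

/-- Initial segments of the constructed set are reached after finitely many stages. -/
theorem exists_charPrefix_pdomSet_eq (s : ℕ) :
    ∃ T, ∀ t ≥ T, charPrefix {k | Enumerated t k} s = charPrefix pdomSet s := by
  have h : ∀ k, ∃ T, k ∈ pdomSet → Enumerated T k := fun k => by
    by_cases hk : k ∈ pdomSet
    · exact hk.imp fun T hT _ => hT
    · exact ⟨0, fun h => absurd h hk⟩
  choose f hf using h
  refine ⟨(Finset.range s).sup f, fun t ht => charPrefix_congr fun k hk => ⟨fun h => ⟨t, h⟩,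
    fun h => ?_⟩⟩
  exact isPriorityConstruction.mono
    ((Finset.le_sup (f := f) (Finset.mem_range.2 hk)).trans ht) (hf k h)

theorem mem_jump_pdomSet_iff (i : ℕ) :
    i ∈ jump pdomSet ↔ ∃ T, ∀ t ≥ T, use i (state t) ≤ t := by
  rw [mem_jump_iff]
  constructor
  · rintro ⟨s, hs⟩
    obtain ⟨T, hT⟩ := exists_charPrefix_pdomSet_eq s
    refine ⟨max s T, fun t ht => ?_⟩
    have h := (use_le_length_iff (i := i) (l := state t)).2
    rw [length_state] at h
    refine h ⟨s, by omega, ?_⟩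
    rwa [take_state (by omega), hT t (by omega)]
  · rintro ⟨T, hT⟩
    obtain ⟨b, hb⟩ := (finite_level_le i).bddAbove
    -- past stage `t`, requirement `i` is not injured any more
    let t := max T (b + 1)
    have ht := hT t (le_max_left _ _)
    have hlev : ∀ u ≥ t, i < level u := fun u hu => by
      by_contra hle
      have := hb (show level u ≤ i from not_lt.1 hle)
      have := le_max_right T (b + 1)
      omega
    refine ⟨use i (state t), ?_⟩
    have h := ((use_eq_iff (by simpa using ht)).1 (Eq.refl (use i (state t)))).1
    rw [take_state ht] at h
    rwa [charPrefix_congr (B := {k | Enumerated t k})]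
    exact fun k hk => ⟨fun ⟨u, hu⟩ => isPriorityConstruction.of_lt_use ht hlev hk hu,
      fun h => ⟨t, h⟩⟩

theorem superlow_pdomSet : Superlow pdomSet := by
  have hp : PrimrecRel fun i t : ℕ => use i (state t) ≤ t :=
    (Primrec.nat_le.comp (primrec₂_use.comp Primrec.fst (primrec_state.comp Primrec.snd))
      Primrec.snd).primrecRel
  have hb : Primrec fun i : ℕ => 2 * ((i + 1) * 2 ^ (i + 2) + (i + 1)) + 1 :=
    Primrec.nat_double_succ.comp (Primrec.nat_add.comp (Primrec.nat_mul.comp Primrec.succ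
      (primrec_two_pow.comp (Primrec.succ.comp Primrec.succ))) Primrec.succ)
  refine ttReducible_of_changes_le hp hb (fun i h => ?_) mem_jump_pdomSet_iff fun i t => ?_
  · obtain ⟨s, -, hs⟩ := use_le_length_iff.1 (show use i (state 0) ≤ (state 0).length from h)
    exact not_converges_nil i (by simpa [state] using hs)
  · refine (isPriorityConstruction.changes_le i t).trans (Nat.add_le_add
      (Nat.mul_le_mul_left 2 (card_level_le i t)) ?_)
    split_ifs <;> omega

/-! ### Pdominance -/

open Classical in
/-- The number of stages before `s` that have the level of `s` and are never enumerated. -/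
noncomputable def rank (s : ℕ) : ℕ :=
  Finset.card {r ∈ Finset.range s | level r = level s ∧ ¬ ∃ t, Enumerated t r}

theorem rank_lt_rank {r s : ℕ} (h : r < s) (hr : r ∉ pdomSet) (hrs : level r = level s) :
    rank r < rank s := by
  classical
  refine Finset.card_lt_card (Finset.ssubset_iff.2 ⟨r, by simp, fun k hk => ?_⟩)
  rw [Finset.mem_insert, Finset.mem_filter, Finset.mem_range] at hk
  rw [Finset.mem_filter, Finset.mem_range]
  rcases hk with rfl | hk
  · exact ⟨h, hrs, hr⟩
  · exact ⟨hk.1.trans h, hk.2.1.trans hrs, hk.2.2⟩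

/-- The position `y` at which a surviving stage `s` becomes a value. Positions of level `n` lie
between `2 ^ n` and `2 ^ (n + 1)`. -/
noncomputable def position (s : ℕ) : ℕ :=
  2 ^ level s + rank s

theorem position_lt {s : ℕ} (hs : s ∉ pdomSet) : position s < 2 ^ (level s + 1) := by
  have := isPriorityConstruction.card_lt_two_pow (s := s) fun t ht => hs ⟨t, ht⟩
  rw [position, pow_succ, mul_two]
  exact Nat.add_lt_add_left this _

theorem position_injOn : Set.InjOn position pdomSetᶜ := by
  intro r hr s hs h
  have key : ∀ {r s : ℕ}, r ∉ pdomSet → s ∉ pdomSet → position r = position s →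
      level r ≤ level s := by
    intro r s _ hs h
    have h1 : 2 ^ level r ≤ position r := Nat.le_add_right _ _
    have := (Nat.pow_lt_pow_iff_right (a := 2) (by omega)).1
      (h1.trans_lt (h.trans_lt (position_lt hs)))
    omega
  have hlev : level r = level s := le_antisymm (key hr hs h) (key hs hr h.symm)
  have hrank : rank r = rank s := by
    rw [position, position, hlev] at h
    omega
  rcases lt_trichotomy r s with hlt | heq | hlt
  · exact absurd hrank (rank_lt_rank hlt hr hlev).ne
  · exact heq
  · exact absurd hrank.symm (rank_lt_rank hlt hs hlev.symm).ne

/-- `s` survives and has position `y`, as seen from the first `s + 1` bits `l` of the constructed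
set. -/
def HasPosition (y s : ℕ) (l : List Bool) : Prop :=
  l.getD s false = false ∧ y = 2 ^ level s +
    ((List.range s).filter fun r => level r = level s ∧ l.getD r false = false).length

theorem primrecPred_hasPosition :
    PrimrecPred fun x : ℕ × ℕ × List Bool => HasPosition x.1 x.2.1 x.2.2 := by
  have hs : Primrec fun x : ℕ × ℕ × List Bool => x.2.1 := Primrec.fst.comp Primrec.snd
  have hl : Primrec fun x : ℕ × ℕ × List Bool => x.2.2 := Primrec.snd.comp Primrec.snd
  have hR : PrimrecRel fun (r : ℕ) (x : ℕ × ℕ × List Bool) =>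
      level r = level x.2.1 ∧ x.2.2.getD r false = false :=
    ((Primrec.eq.comp (primrec_level.comp Primrec.fst)
      (primrec_level.comp (hs.comp Primrec.snd))).and
      (Primrec.eq.comp ((Primrec.list_getD false).comp (hl.comp Primrec.snd) Primrec.fst)
        (Primrec.const false))).primrecRel
  exact (Primrec.eq.comp ((Primrec.list_getD false).comp hl hs) (Primrec.const false)).and
    (Primrec.eq.comp Primrec.fst (Primrec.nat_add.comp
      (primrec_two_pow.comp (primrec_level.comp hs))
      (Primrec.list_length.comp (hR.listFilter.comp (Primrec.list_range.comp hs) Primrec.id))))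

theorem hasPosition_charPrefix_iff (y s : ℕ) :
    HasPosition y s (charPrefix pdomSet (s + 1)) ↔ s ∉ pdomSet ∧ y = position s := by
  classical
  have h : ∀ r ≤ s, (charPrefix pdomSet (s + 1)).getD r false = false ↔ r ∉ pdomSet := by
    intro r hr
    rw [List.getD_eq_getElem?_getD, getElem?_charPrefix (by omega)]
    simp
  have hrank : ((List.range s).filter fun r => level r = level s ∧
      (charPrefix pdomSet (s + 1)).getD r false = false).length = rank s := by
    have : (List.range s).filter (fun r => level r = level s ∧
        (charPrefix pdomSet (s + 1)).getD r false = false) =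
        (List.range s).filter fun r => level r = level s ∧ ¬ ∃ t, Enumerated t r := by
      refine List.filter_congr fun r hr => ?_
      rw [decide_eq_decide, h r (List.mem_range.1 hr).le]
      rfl
    rw [this]
    rfl
  rw [HasPosition, h s le_rfl, hrank, position]

theorem pDominant_pdomSet : PDominant pdomSet := by
  obtain ⟨ψ, hψA, hψ⟩ := exists_partialRecIn_search pdomSet primrecPred_hasPosition
  refine ⟨ψ, hψA, fun φ hφ => ?_⟩
  have hval : ∀ s ∉ pdomSet, s + 1 ∈ ψ (position s) := by
    intro s hs
    rw [hψ]
    refine ⟨s, rfl, (hasPosition_charPrefix_iff _ _).2 ⟨hs, rfl⟩, fun r hrs hr => ?_⟩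
    rw [hasPosition_charPrefix_iff] at hr
    exact hrs.ne' (position_injOn hs hr.1 hr.2)
  obtain ⟨c, rfl⟩ := Code.exists_code.1 hφ
  rw [PDominates, Nat.cofinite_eq_atTop, Filter.eventually_atTop]
  refine ⟨2 ^ (encode c + 1), fun x hx v hv => ?_⟩
  obtain ⟨n, hn⟩ : ∃ n, Nat.log 2 x = n + 1 := by
    refine Nat.exists_eq_succ_of_ne_zero fun h0 => ?_
    have := Nat.le_log_of_pow_le (by omega) hx
    omega
  have hx0 : x ≠ 0 := by
    rintro rfl
    simp at hn
  have hen : encode c ≤ n := by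
    have := Nat.le_log_of_pow_le (by omega) hx
    omega
  have hk := Code.evaln_complete.1 hv
  classical
  -- the stage that sees the convergence of the computation
  have hev : IsEvent (n, encode c, x, Nat.find hk, v) := by
    refine ⟨hen, ?_, ?_, ?_, ?_⟩
    · exact hn ▸ Nat.pow_log_le_self 2 hx0
    · have := Nat.lt_pow_succ_log_self (b := 2) (by omega) x
      rwa [hn] at this
    · simpa using Nat.find_spec hk
    · simp only [Denumerable.ofNat_encode]
      have hpos : Nat.find hk ≠ 0 := by
        intro h0
        have := Nat.find_spec hk
        rw [h0] at this
        simp [Code.evaln] at this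
      rw [Option.eq_none_iff_forall_not_mem]
      intro w hw
      have hwv := Code.evaln_mono (Nat.sub_le _ 1) hw
      have : w = v := Option.mem_unique hwv (Nat.find_spec hk)
      exact Nat.find_min hk (by omega) (this ▸ hw)
  obtain ⟨s, hts, hlev, hs⟩ := isPriorityConstruction.exists_survivor finite_level_le
    (encode (n, encode c, x, Nat.find hk, v))
  rw [level_encode hev] at hlev
  have hsA : s ∉ pdomSet := fun ⟨t, ht⟩ => hs t ht
  refine ⟨position s, ?_, s + 1, hval s hsA, ?_⟩
  · have h1 : 2 ^ (level s + 1) ≤ 2 ^ (n + 1) := Nat.pow_le_pow_right (by omega) (by omega)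
    exact (position_lt hsA).le.trans (h1.trans hev.2.1)
  · have : v ≤ encode (n, encode c, x, Nat.find hk, v) := by
      simp only [Encodable.encode_prod_val, encode_nat]
      exact ((Nat.right_le_pair _ _).trans (Nat.right_le_pair _ _)).trans
        ((Nat.right_le_pair _ _).trans (Nat.right_le_pair _ _))
    omega

end PDom

theorem theorem5p1 :
    ∃ A : Set ℕ, REPred (fun n => n ∈ A) ∧ PDom.PDominant A ∧ PDom.Low A ∧ PDom.Superlow A := by
  exact ⟨PDom.pdomSet, PDom.rePred_pdomSet, PDom.pDominant_pdomSet,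
    PDom.superlow_pdomSet.turingLE, PDom.superlow_pdomSet⟩
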